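/- Graphs are finite and undirected, and every vertex is regarded as adjacent to itself; $\delta_G$ is the shortest-path distance in $G$, $G^m$ is the graph on the vertices of $G$ in which $u,v$ are adjacent iff $\delta_G(u,v)\le m$, $\alpha(G)$ is the independence number (the largest number of pairwise distinct, pairwise non-adjacent vertices), and $\boxtimes$ is the strong product. Setting. Let $N$ be a graph on a finite set $A$ of agents, $F$ a graph on a finite set $K$ of actions with $|K|\ge 2$, and $n,f\ge 0$ integers. Let $q(v)\in[0,1]$ be activation probabilities, and $\ell_1,\ell_2,\dots\colon K\to[0,1]$ losses fixed in advance. In each round $t=1,\dots,T$, every agent $v$ is activated with probability $q(v)$, independently of the past and of the other agents. Let $\mathcal A_t$ be the set of active agents. Each $v\in\mathcal A_t$ draws an action $I_t(v)$ from its current distribution $p_t(\cdot,v)$ and is charged $\ell_t(I_t(v))$. Then each agent $v$ observes the set $\mathcal L_t(v)$ of all timestamped losses $(\ell_{t-s}(i),t-s,i)$ with $0\le s\le f$, $v\in\mathcal A_{t-s}$ and $\delta_F(i,I_{t-s}(v))=s$. It sends the message $(t,v,\mathcal L_t(v),p_t(\cdot,v))$, which every agent $u$ with $\delta_N(u,v)\le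 n$ (including $v$ itself) receives at the end of round $t+\delta_N(u,v)$. Agents with $q(v)=0$ do not take part and send no messages. A strategy chooses each distribution $p_t(\cdot,v)$ as an arbitrary function of the messages that $v$ received before round $t$; it may depend on $N,n,F,f,T$ and $q$. The network regret is $$R_T=\max_{i\in K}\mathbb E\Big[\sum_{t=1}^T\sum_{v\in\mathcal A_t}\ell_t(I_t(v))-\sum_{t=1}^T|\mathcal A_t|\,\ell_t(i)\Big].$$ Theorem. There are universal constants $c,C>0$ such that the following holds. Let $N,n,F,f$ be as above, where at least one of $N$ and $F$ is a clique or an edgeless graph, and let $Q\in(0,\alpha(N^n)]$. Then for all horizons $T$ with $Q\,T\ge C\,\alpha(N^n)\,\alpha(F^f)^3$, $$\inf\ \sup\ R_T\ \ge\ c\,\sqrt{Q\,\alpha\big(N^n\boxtimes F^f\big)\,T},$$ where the infimum is over all strategies of the players, and the supremum is over all losses $\ell_1,\dots,\ell_T$ and all activation probabilities $(q(v))_{v\in A}$ with $\sum_{v\in A}q(v)=Q$. -/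

import Mathlib

noncomputable section

namespace CoopBandit

/-- The `m`-th power of a graph: two distinct vertices are adjacent iff their shortest-path
distance is at most `m` (self-loops are left implicit, as in `SimpleGraph`). -/
def power {V : Type*} (G : SimpleGraph V) (m : ℕ) : SimpleGraph V where
  Adj u v := u ≠ v ∧ G.edist u v ≤ m
  symm := ⟨fun u v h => ⟨h.1.symm, by rw [SimpleGraph.edist_comm]; exact h.2⟩⟩
  loopless := ⟨fun _ h => h.1 rfl⟩

/-- The strong product of two graphs: distinct pairs are adjacent iff in each coordinate they are
equal or adjacent. -/
def strongProd {V W : Type*} (G : SimpleGraph V) (H : SimpleGraph W) : SimpleGraph (V × W) where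
  Adj x y := x ≠ y ∧ (x.1 = y.1 ∨ G.Adj x.1 y.1) ∧ (x.2 = y.2 ∨ H.Adj x.2 y.2)
  symm := ⟨fun _ _ h => ⟨h.1.symm, h.2.1.imp Eq.symm (fun a => a.symm),
    h.2.2.imp Eq.symm (fun a => a.symm)⟩⟩
  loopless := ⟨fun _ h => h.1 rfl⟩

/-- The content of the feedback message that an agent sends out at the end of a round: the set of
timestamped losses `(loss, round, action)` that it observed in that round, and the distribution
that it used in that round. The round of dispatch and the sender index the inbox below. -/
structure Message (K : Type*) [Fintype K] where
  losses : Set (ℝ × ℕ × K)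
  dist : stdSimplex ℝ K

/-- What an agent has received so far: `inbox s u` is the message sent by agent `u` in round `s`,
or `none` if no such message has arrived. -/
abbrev Inbox (A K : Type*) [Fintype K] := ℕ → A → Option (Message K)

/-- A strategy of the players. It is told all the activation probabilities, and prescribes, for
each round and each agent, the distribution of the action of this agent as an arbitrary function of
its inbox. Since strategies are chosen with the two graphs, the delays and the
horizon known, it may depend on these too. -/
abbrev Strategy (A K : Type*) [Fintype K] :=
  (A → ℝ) → ℕ → A → Inbox A K → stdSimplex ℝ K

/-- A play: `h t v = some i` if agent `v` is active in round `t` and plays action `i`, and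
`h t v = none` if `v` is not active in round `t`. Rounds are numbered `0, 1, 2, …`. -/
abbrev Play (A K : Type*) := ℕ → A → Option K

/-- The timestamped losses observed by agent `v` in round `t`: if `v` was active in the
round `t - s`, with `s ≤ f`, it now observes the losses in that round of all the actions at distance
exactly `s` from the action that it played then. -/
def observed {A K : Type*} (F : SimpleGraph K) (f : ℕ) (ℓ : ℕ → K → ℝ) (h : Play A K)
    (t : ℕ) (v : A) : Set (ℝ × ℕ × K) :=
  {x | ∃ s r : ℕ, ∃ i j : K, s ≤ f ∧ r + s = t ∧ h r v = some j ∧ F.edist i j = s ∧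
    x = (ℓ r i, r, i)}

open scoped Classical in
/-- The distributions `p_t(·, v)` used by the agents along a play. In round `t`, agent `v` has
received (by the end of round `t - 1`) the messages which agents `u` at distance
`δ(u, v) ≤ n` sent in rounds `s` with `s + δ(u, v) ≤ t - 1`; in particular it has its own
observations. Agents whose activation probability is `0` do not take part and send nothing. -/
def actionDist {A K : Type*} [Fintype K] (N : SimpleGraph A) (n : ℕ) (F : SimpleGraph K) (f : ℕ)
    (σ : Strategy A K) (q : A → ℝ) (ℓ : ℕ → K → ℝ) (h : Play A K) (t : ℕ) (v : A) :
    stdSimplex ℝ K :=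
  σ q t v fun s u =>
    if _hs : s < t ∧ (s : ℕ∞) + N.edist u v < t ∧ N.edist u v ≤ n ∧ 0 < q u then
      some ⟨observed F f ℓ h s u, actionDist N n F f σ q ℓ h s u⟩
    else none
termination_by t
decreasing_by exact _hs.1

/-- The probability that an agent is inactive (`none`), or is active and plays `i` (`some i`), when
its activation probability is `q` and its distribution over actions is `p`. -/
def moveProb {K : Type*} [Fintype K] (q : ℝ) (p : stdSimplex ℝ K) : Option K → ℝ
  | none => 1 - q
  | some i => q * p i

/-- A sequence of `T` rounds seen as a play (nobody is active afterwards). -/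
def extend {A K : Type*} {T : ℕ} (x : Fin T → A → Option K) : Play A K :=
  fun t v => if ht : t < T then x ⟨t, ht⟩ v else none

/-- The probability of the sequence of moves `x` in the first `T` rounds: in each round, given the
past, the agents are activated independently of each other and draw their actions independently
from their current distributions. -/
def playProb {A K : Type*} [Fintype A] [Fintype K] (N : SimpleGraph A) (n : ℕ)
    (F : SimpleGraph K) (f : ℕ) (σ : Strategy A K) (q : A → ℝ) (ℓ : ℕ → K → ℝ) {T : ℕ}
    (x : Fin T → A → Option K) : ℝ :=
  ∏ t : Fin T, ∏ v : A, moveProb (q v) (actionDist N n F f σ q ℓ (extend x) t v) (x t v)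

/-- The number of agents that are active when the moves are `y`. -/
def numActive {A K : Type*} [Fintype A] (y : A → Option K) : ℕ :=
  (Finset.univ.filter fun v => (y v).isSome).card

/-- The total loss charged to the active agents when the moves are `y` and the losses are `l`. -/
def chargedLoss {A K : Type*} [Fintype A] (l : K → ℝ) (y : A → Option K) : ℝ :=
  ∑ v : A, (y v).elim 0 l

/-- The network regret `R_T`: the maximum over the actions `i` of the expectation of
`∑_t ∑_{v active} ℓ_t(I_t(v)) - ∑_t |{active}| ℓ_t(i)`. -/
def regret {A K : Type*} [Fintype A] [DecidableEq A] [Fintype K] (N : SimpleGraph A) (n : ℕ)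
    (F : SimpleGraph K) (f : ℕ) (T : ℕ) (σ : Strategy A K) (q : A → ℝ) (ℓ : ℕ → K → ℝ) : ℝ :=
  ⨆ i : K, ∑ x : Fin T → A → Option K, playProb N n F f σ q ℓ x *
    ((∑ t : Fin T, chargedLoss (ℓ t) (x t)) - ∑ t : Fin T, (numActive (x t) : ℝ) * ℓ t i)

/-- The assignments of activation probabilities with expected number of active agents `Q`. -/
def IsActivation {A : Type*} [Fintype A] (Q : ℝ) (q : A → ℝ) : Prop :=
  (∀ v, q v ∈ Set.Icc (0 : ℝ) 1) ∧ ∑ v, q v = Q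

/-- The minimax network regret `inf_σ sup_{q, ℓ} R_T`, where `q` ranges over the activation
probabilities with sum `Q` and `ℓ` over the sequences of losses with values in `[0, 1]`. -/
def minimaxRegret {A K : Type*} [Fintype A] [DecidableEq A] [Fintype K] (N : SimpleGraph A)
    (n : ℕ) (F : SimpleGraph K) (f : ℕ) (Q : ℝ) (T : ℕ) : EReal :=
  ⨅ σ : Strategy A K, ⨆ q : {q : A → ℝ // IsActivation Q q},
    ⨆ ℓ : {ℓ : ℕ → K → ℝ // ∀ t i, ℓ t i ∈ Set.Icc (0 : ℝ) 1},
      ((regret N n F f T σ q.1 ℓ.1 : ℝ) : EReal)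

end CoopBandit

end

noncomputable section

namespace CoopBandit

open Finset
open scoped BigOperators

/-! ### Graphs -/

/-! Only the agents of a maximum independent set of N^n are activated, each with probability Q/a,
where a = α(N^n). No two of them are within distance n, so none hears another: the law of the play
factors over agents (`playProb_eq_prod`), and regret against a fixed action is a sum of single-agent
regrets (`sum_runRegret_le_regret`), each active agent making QT/a plays in expectation.

`exists_hard_actions` gives a set U of m actions, m of the order of α(F^f), each revealing at most
two losses in U. Losses outside U are 1; losses in U are independent bits, all fair except that in
environment i ∈ U the action i has mean (1 - δ)/2. Passing from fair bits to environment i changes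
play rates by an amount controlled by δ² times the expected number of revelations of i under fair
bits (`envRate_le`). Summed over i ∈ U, these numbers are at most twice the number of plays plus m
times the number of plays outside U (`sum_revealRate_le`). For δ² = ma/(128QT) the first part is too
small to identify i, and the average environment costs order δQT, that is √(maQT).

Plays outside U may reveal all of U, but each costs 1/2 extra under fair bits, so their expected
number is at most 2R, with R the largest regret over bit sequences. Once mδ ≤ 1, the information
they buy is worth only a small fraction of R; this condition produces the cube in the assumption on
T.

Finally ma ≥ α(N^n ⊠ F^f), because one factor is a clique or edgeless
(`indepNum_strongProd_power_le`). -/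

lemma power_eq_top_or_bot {V : Type*} (G : SimpleGraph V) (m : ℕ) (h : G = ⊤ ∨ G = ⊥) :
    power G m = ⊤ ∨ power G m = ⊥ := by
  rcases h with rfl | rfl
  · rcases Nat.eq_zero_or_pos m with rfl | hm
    · right
      ext u v
      simp only [power, SimpleGraph.bot_adj, iff_false, not_and]
      intro huv h
      exact huv (by simpa using h)
    · left
      ext u v
      simp only [power, SimpleGraph.top_adj, and_iff_left_iff_imp]
      intro huv
      have : (⊤ : SimpleGraph V).edist u v = 1 := by
        rw [SimpleGraph.edist_eq_one_iff_adj]; exact huv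
      rw [this]
      exact_mod_cast hm
  · right
    ext u v
    simp only [power, SimpleGraph.bot_adj, iff_false, not_and]
    intro huv h
    rw [SimpleGraph.edist_bot_of_ne huv] at h
    simp at h

lemma indepNum_pos {V : Type*} [Finite V] [Nonempty V] (G : SimpleGraph V) : 0 < G.indepNum := by
  classical
  have := Fintype.ofFinite V
  obtain ⟨v⟩ := ‹Nonempty V›
  have h : G.IsIndepSet (({v} : Finset V) : Set V) := by simp [SimpleGraph.IsIndepSet]
  exact h.card_le_indepNum

/-- The independence number of a strong product is at most that of the second factor times the size
of a clique cover of the first. -/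
lemma indepNum_strongProd_le_of_cover {V W ι : Type*} [Fintype V] [Fintype W] [Fintype ι]
    (G : SimpleGraph V) (H : SimpleGraph W) (π : V → ι)
    (hπ : ∀ u v, π u = π v → u = v ∨ G.Adj u v) :
    (strongProd G H).indepNum ≤ Fintype.card ι * H.indepNum := by
  classical
  obtain ⟨I, hI⟩ := (strongProd G H).exists_isNIndepSet_indepNum
  rw [← hI.card_eq]
  have hind := hI.isIndepSet
  rw [← Finset.card_univ, mul_comm]
  refine Finset.card_le_mul_card_image_of_maps_to (f := fun x : V × W => π x.1)
    (fun _ _ => mem_univ _) _ fun a _ => ?_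
  -- Over one clique of the cover, two distinct elements of `I` with equal or adjacent second
  -- coordinates would be adjacent in the product.
  have hinj : Set.InjOn Prod.snd (↑(I.filter fun x : V × W => π x.1 = a) : Set (V × W)) := by
    intro x hx y hy hxy
    simp only [coe_filter, Set.mem_ofPred_eq] at hx hy
    by_contra hne
    exact hind hx.1 hy.1 hne ⟨hne, hπ _ _ (hx.2.trans hy.2.symm), Or.inl hxy⟩
  rw [← Finset.card_image_of_injOn hinj]
  apply SimpleGraph.IsIndepSet.card_le_indepNum
  intro w hw w' hw' hne hadj
  simp only [coe_image, coe_filter, Set.mem_image, Set.mem_ofPred_eq] at hw hw'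
  obtain ⟨x, hx, rfl⟩ := hw
  obtain ⟨y, hy, rfl⟩ := hw'
  have hxy : x ≠ y := fun h => hne (by rw [h])
  exact hind hx.1 hy.1 hxy ⟨hxy, hπ _ _ (hx.2.trans hy.2.symm), Or.inr hadj⟩

lemma indepNum_strongProd_comm_le {V W : Type*} [Fintype V] [Fintype W]
    (G : SimpleGraph V) (H : SimpleGraph W) :
    (strongProd G H).indepNum ≤ (strongProd H G).indepNum := by
  classical
  obtain ⟨I, hI⟩ := (strongProd G H).exists_isNIndepSet_indepNum
  rw [← hI.card_eq, ← Finset.card_image_of_injective I Prod.swap_injective]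
  apply SimpleGraph.IsIndepSet.card_le_indepNum
  intro w hw w' hw' hne hadj
  simp only [coe_image, Set.mem_image] at hw hw'
  obtain ⟨x, hx, rfl⟩ := hw
  obtain ⟨y, hy, rfl⟩ := hw'
  have hxy : x ≠ y := fun h => hne (by rw [h])
  exact hI.isIndepSet hx hy hxy ⟨hxy, hadj.2.2, hadj.2.1⟩

/-- A clique is covered by one class, an edgeless graph by its singletons; in both cases the cover
is no larger than the independence number. -/
lemma indepNum_strongProd_le_left {V W : Type*} [Fintype V] [Fintype W] [Nonempty V]
    (G : SimpleGraph V) (H : SimpleGraph W) (hG : G = ⊤ ∨ G = ⊥) :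
    (strongProd G H).indepNum ≤ G.indepNum * H.indepNum := by
  classical
  rcases hG with rfl | rfl
  · refine (indepNum_strongProd_le_of_cover _ H (fun _ : V => ()) fun u v _ => ?_).trans ?_
    · exact eq_or_ne u v
    · exact Nat.mul_le_mul_right _ (by rw [Fintype.card_unit]; exact indepNum_pos (⊤ : SimpleGraph V))
  · refine (indepNum_strongProd_le_of_cover _ H (fun v : V => v) fun u v h => Or.inl h).trans ?_
    refine Nat.mul_le_mul_right _ ?_
    rw [← Finset.card_univ]
    apply SimpleGraph.IsIndepSet.card_le_indepNum
    intro u _ v _ _ h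
    simp at h

lemma indepNum_strongProd_power_le {A K : Type*} [Fintype A] [Fintype K] [Nonempty A] [Nonempty K]
    (N : SimpleGraph A) (n : ℕ) (F : SimpleGraph K) (f : ℕ)
    (h : N = ⊤ ∨ N = ⊥ ∨ F = ⊤ ∨ F = ⊥) :
    (strongProd (power N n) (power F f)).indepNum ≤
      (power N n).indepNum * (power F f).indepNum := by
  have key : (N = ⊤ ∨ N = ⊥) ∨ (F = ⊤ ∨ F = ⊥) := by tauto
  rcases key with h | h
  · exact indepNum_strongProd_le_left _ _ (power_eq_top_or_bot _ _ h)
  · rw [mul_comm]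
    exact (indepNum_strongProd_comm_le _ _).trans
      (indepNum_strongProd_le_left _ _ (power_eq_top_or_bot _ _ h))

open scoped Classical in
/-- There is a set of at least two actions, of the order of the independence number of `F ^ f`, each
of which reveals at most two of them. -/
lemma exists_hard_actions {K : Type*} [Fintype K] [Nontrivial K] (F : SimpleGraph K) (f : ℕ) :
    ∃ U : Finset K, 2 ≤ #U ∧ (power F f).indepNum ≤ #U ∧ #U ≤ 2 * (power F f).indepNum ∧
      ∀ j ∈ U, #{i ∈ U | F.edist i j ≤ f} ≤ 2 := by
  rcases le_or_gt 2 (power F f).indepNum with h2 | h2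
  · obtain ⟨U, hU⟩ := (power F f).exists_isNIndepSet_indepNum
    refine ⟨U, hU.card_eq ▸ h2, hU.card_eq.ge, by rw [hU.card_eq]; omega, fun j hj => ?_⟩
    refine (Finset.card_le_card (t := {j}) ?_).trans (by simp)
    intro i hi
    simp only [mem_filter] at hi
    by_contra hne
    simp only [mem_singleton] at hne
    exact hU.isIndepSet (by simpa using hi.1) (by simpa using hj) hne ⟨hne, hi.2⟩
  -- With independence number one, any two actions serve. They may reveal each other, whence the
  -- bound two instead of one.
  · have h1 := indepNum_pos (power F f)
    obtain ⟨a, b, hab⟩ := exists_pair_ne K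
    have hc : #({a, b} : Finset K) = 2 := Finset.card_pair hab
    exact ⟨{a, b}, hc.ge, by omega, by omega, fun j _ => (Finset.card_filter_le _ _).trans hc.le⟩

/-! ### A single agent -/

/-- The moves of an agent in `T` rounds, continued by inactivity. -/
def extendRun {K : Type*} {T : ℕ} (y : Fin T → Option K) : ℕ → Option K :=
  fun t => if ht : t < T then y ⟨t, ht⟩ else none

lemma extendRun_apply {K : Type*} {T : ℕ} (y : Fin T → Option K) (t : Fin T) :
    extendRun y t = y t := by simp [extendRun]

lemma extendRun_snoc {K : Type*} {T : ℕ} (y : Fin T → Option K) (o : Option K) :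
    extendRun (Fin.snoc (α := fun _ => Option K) y o) = Function.update (extendRun y) T o := by
  ext1 t
  rcases lt_trichotomy t T with h | rfl | h
  · simp [extendRun, Fin.snoc, h, h.ne, h.trans (Nat.lt_succ_self T)]
  · simp [extendRun, Fin.snoc]
  · simp [extendRun, h.ne', h.not_gt, h.not_ge]

/-- A policy of a single agent: its distribution in each round, given its moves and the losses. -/
abbrev Policy (K : Type*) [Fintype K] := ℕ → (ℕ → Option K) → (ℕ → K → ℝ) → stdSimplex ℝ K

/-- The policy uses only the earlier moves, and the earlier losses of the actions within distance
`f` of the action then played. -/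
def Policy.IsLocal {K : Type*} [Fintype K] (F : SimpleGraph K) (f : ℕ) (p : Policy K) : Prop :=
  ∀ t h h' ℓ ℓ', (∀ r < t, h r = h' r) →
    (∀ r < t, ∀ i j, h r = some j → F.edist i j ≤ f → ℓ r i = ℓ' r i) → p t h ℓ = p t h' ℓ'

section Run

variable {K : Type*} [Fintype K]

lemma moveProb_nonneg {q : ℝ} (h0 : 0 ≤ q) (h1 : q ≤ 1) (p : stdSimplex ℝ K) (o : Option K) :
    0 ≤ moveProb q p o := by
  cases o with
  | none => simpa [moveProb] using h1
  | some i => exact mul_nonneg h0 (p.2.1 i)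

lemma sum_moveProb (q : ℝ) (p : stdSimplex ℝ K) : ∑ o, moveProb q p o = 1 := by
  have : ∑ i, p i = 1 := p.2.2
  simp [Fintype.sum_option, moveProb, ← Finset.mul_sum, this]

/-- The probability of the moves `y` of a single agent. -/
def runProb (p : Policy K) (q : ℝ) (ℓ : ℕ → K → ℝ) {T : ℕ} (y : Fin T → Option K) : ℝ :=
  ∏ t : Fin T, moveProb q (p t (extendRun y) ℓ) (y t)

lemma runProb_nonneg (p : Policy K) {q : ℝ} (h0 : 0 ≤ q) (h1 : q ≤ 1) (ℓ : ℕ → K → ℝ) {T : ℕ}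
    (y : Fin T → Option K) : 0 ≤ runProb p q ℓ y :=
  prod_nonneg fun _ _ => moveProb_nonneg h0 h1 _ _

/-- The probability that the agent is active in round `t` and plays `j`. -/
def playRate (p : Policy K) (q : ℝ) (ℓ : ℕ → K → ℝ) (t : ℕ) (j : K) : ℝ :=
  ∑ y : Fin t → Option K, runProb p q ℓ y * (q * p t (extendRun y) ℓ j)

lemma playRate_nonneg (p : Policy K) {q : ℝ} (h0 : 0 ≤ q) (h1 : q ≤ 1) (ℓ : ℕ → K → ℝ) (t : ℕ)
    (j : K) : 0 ≤ playRate p q ℓ t j :=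
  sum_nonneg fun y _ => mul_nonneg (runProb_nonneg p h0 h1 ℓ y)
    (mul_nonneg h0 ((p t (extendRun y) ℓ).2.1 j))

variable {F : SimpleGraph K} {f : ℕ} {p : Policy K}

lemma sum_runProb_succ (hp : p.IsLocal F f) (q : ℝ) (ℓ : ℕ → K → ℝ) (T : ℕ)
    (g : (ℕ → Option K) → ℝ) :
    ∑ y : Fin (T + 1) → Option K, runProb p q ℓ y * g (extendRun y) =
      ∑ y : Fin T → Option K, runProb p q ℓ y *
        ∑ o, moveProb q (p T (extendRun y) ℓ) o * g (Function.update (extendRun y) T o) := by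
  rw [← (Fin.snocEquiv fun _ : Fin (T + 1) => Option K).sum_comp, Fintype.sum_prod_type_right]
  refine sum_congr rfl fun y _ => ?_
  rw [mul_sum]
  refine sum_congr rfl fun o _ => ?_
  simp only [Fin.snocEquiv, Equiv.coe_fn_mk, extendRun_snoc]
  rw [← mul_assoc]
  congr 1
  rw [runProb, Fin.prod_univ_castSucc, runProb, extendRun_snoc]
  congr 1
  · refine prod_congr rfl fun s _ => ?_
    simp only [Fin.snoc_castSucc, Fin.val_castSucc]
    congr 1
    refine hp _ _ _ _ _ (fun r hr => ?_) (fun _ _ _ _ _ _ => rfl)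
    exact Function.update_of_ne (by have := s.2; omega) _ _
  · simp only [Fin.snoc_last, Fin.val_last]
    congr 1
    refine hp _ _ _ _ _ (fun r hr => ?_) (fun _ _ _ _ _ _ => rfl)
    exact Function.update_of_ne (by omega) _ _

/-- Later moves integrate out, since each conditional law has mass one. -/
lemma sum_runProb_of_le (hp : p.IsLocal F f) (q : ℝ) (ℓ : ℕ → K → ℝ) {t T : ℕ} (htT : t ≤ T)
    (g : (ℕ → Option K) → ℝ) (hg : ∀ h h', (∀ r < t, h r = h' r) → g h = g h') :
    ∑ y : Fin T → Option K, runProb p q ℓ y * g (extendRun y) =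
      ∑ y : Fin t → Option K, runProb p q ℓ y * g (extendRun y) := by
  induction T, htT using Nat.le_induction with
  | base => rfl
  | succ T htT ih =>
    rw [sum_runProb_succ hp, ← ih]
    refine sum_congr rfl fun y _ => ?_
    congr 1
    have : ∀ o, g (Function.update (extendRun y) T o) = g (extendRun y) := fun o =>
      hg _ _ fun r hr => Function.update_of_ne (by omega) _ _
    simp only [this, ← sum_mul, sum_moveProb, one_mul]

lemma sum_runProb (hp : p.IsLocal F f) (q : ℝ) (ℓ : ℕ → K → ℝ) (T : ℕ) :
    ∑ y : Fin T → Option K, runProb p q ℓ y = 1 := by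
  have := sum_runProb_of_le hp q ℓ (Nat.zero_le T) (fun _ => 1) (fun _ _ _ => rfl)
  simpa [runProb] using this

lemma playRate_eq_sum (hp : p.IsLocal F f) (q : ℝ) (ℓ : ℕ → K → ℝ) {T : ℕ} (t : Fin T) (j : K) :
    playRate p q ℓ t j =
      q * ∑ y : Fin T → Option K, runProb p q ℓ y * p t (extendRun y) ℓ j := by
  rw [sum_runProb_of_le hp q ℓ t.2.le (fun h => p t h ℓ j), playRate, mul_sum]
  · exact sum_congr rfl fun y _ => by ring
  · intro h h' hh
    rw [hp t h h' ℓ ℓ hh fun _ _ _ _ _ _ => rfl]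

lemma sum_playRate (hp : p.IsLocal F f) (q : ℝ) (ℓ : ℕ → K → ℝ) (t : ℕ) :
    ∑ j, playRate p q ℓ t j = q := by
  simp only [playRate]
  rw [sum_comm]
  have : ∀ y : Fin t → Option K, ∑ j, p t (extendRun y) ℓ j = 1 := fun y => (p _ _ _).2.2
  simp only [← mul_sum, this, ← sum_mul, sum_runProb hp, one_mul, mul_one]

/-- The expectation of a function of the move in round `t`. -/
lemma sum_runProb_mul_move (hp : p.IsLocal F f) (q : ℝ) (ℓ : ℕ → K → ℝ) {T : ℕ} (t : Fin T)
    (H : Option K → ℝ) (hH : H none = 0) :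
    ∑ y : Fin T → Option K, runProb p q ℓ y * H (y t) =
      ∑ j, playRate p q ℓ t j * H (some j) := by
  have h1 := sum_runProb_of_le hp q ℓ (Nat.succ_le_of_lt t.2) (fun h => H (h t))
    (fun h h' hh => by rw [hh _ (Nat.lt_succ_self _)])
  simp only [extendRun_apply] at h1
  rw [h1]
  have h2 := sum_runProb_succ hp q ℓ (t : ℕ) (fun h => H (h t))
  simp only [Function.update_self] at h2
  refine h2.trans ?_
  simp only [playRate, sum_mul]
  rw [sum_comm]
  refine sum_congr rfl fun y _ => ?_
  rw [Fintype.sum_option, hH, mul_zero, zero_add, mul_sum]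
  exact sum_congr rfl fun j _ => by simp only [moveProb]; ring

/-- The regret of a single agent with respect to the action `i`. -/
def runRegret (p : Policy K) (q : ℝ) (ℓ : ℕ → K → ℝ) (T : ℕ) (i : K) : ℝ :=
  ∑ y : Fin T → Option K, runProb p q ℓ y *
    ∑ t : Fin T, ((y t).elim 0 (ℓ t) - (y t).elim 0 fun _ => ℓ t i)

lemma runRegret_eq (hp : p.IsLocal F f) (q : ℝ) (ℓ : ℕ → K → ℝ) (T : ℕ) (i : K) :
    runRegret p q ℓ T i = ∑ t : Fin T, ∑ j, playRate p q ℓ t j * (ℓ t j - ℓ t i) := by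
  simp only [runRegret, mul_sum]
  rw [sum_comm]
  refine sum_congr rfl fun t _ => ?_
  exact sum_runProb_mul_move hp q ℓ t
    (fun o => o.elim 0 (ℓ t) - o.elim 0 fun _ => ℓ t i) (by simp)

/-- This is what makes the play in round `t` independent of the loss bits of round `t`. -/
lemma playRate_congr (hp : p.IsLocal F f) (q : ℝ) {ℓ ℓ' : ℕ → K → ℝ} {t : ℕ}
    (h : ∀ r < t, ℓ r = ℓ' r) (j : K) : playRate p q ℓ t j = playRate p q ℓ' t j := by
  simp only [playRate, runProb]
  refine sum_congr rfl fun y _ => ?_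
  rw [hp t _ (extendRun y) ℓ ℓ' (fun _ _ => rfl) fun r hr i _ _ _ => by rw [h r hr]]
  congr 1
  refine prod_congr rfl fun s _ => ?_
  rw [hp s _ (extendRun y) ℓ ℓ' (fun _ _ => rfl) fun r hr i _ _ _ => by rw [h r (hr.trans s.2)]]

end Run

/-! ### Random bits -/

section Bits

variable {ι : Type*} [Fintype ι] [DecidableEq ι]

/-- Averaging over `b` and over `b` with bit `e` flipped leaves `G` untouched and replaces `φ` by
its mean. -/
lemma expect_mul_bit (e : ι) (φ : Bool → ℝ) (G : (ι → Bool) → ℝ)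
    (hG : ∀ b c, G (Function.update b e c) = G b) :
    𝔼 b, φ (b e) * G b = (φ true + φ false) / 2 * 𝔼 b, G b := by
  have hinv : Function.Involutive fun b : ι → Bool => Function.update b e (!b e) := by
    intro b
    simp
  have h1 : 𝔼 b, φ (b e) * G b = 𝔼 b, φ (!b e) * G b := by
    rw [Fintype.expect_bijective _ hinv.bijective (fun b => φ (b e) * G b)
      (fun b => φ (!b e) * G b)]
    intro b
    simp [hG]
  have h2 : 𝔼 b, φ (b e) * G b + 𝔼 b, φ (!b e) * G b = (φ true + φ false) * 𝔼 b, G b := by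
    rw [← expect_add_distrib, mul_expect]
    refine expect_congr rfl fun b _ => ?_
    cases b e <;> simp <;> ring
  linarith

/-- The density of a bit that is `false` with probability `(1 + δ) / 2`, relative to a fair one. -/
def tilt (δ : ℝ) (c : Bool) : ℝ := if c then 1 - δ else 1 + δ

lemma tilt_pos {δ : ℝ} (h0 : 0 ≤ δ) (h1 : δ < 1) (c : Bool) : 0 < tilt δ c := by
  unfold tilt
  split_ifs <;> linarith

lemma expect_prod_tilt_mul (δ : ℝ) (D : Finset ι) (G : (ι → Bool) → ℝ)
    (hG : ∀ e ∈ D, ∀ b c, G (Function.update b e c) = G b) :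
    𝔼 b, (∏ e ∈ D, tilt δ (b e)) * G b = 𝔼 b, G b := by
  induction D using Finset.induction_on with
  | empty => simp
  | insert e D he ih =>
    rw [← ih fun e' he' => hG e' (mem_insert_of_mem he')]
    simp only [prod_insert he, mul_assoc]
    rw [expect_mul_bit e (tilt δ)]
    · simp [tilt]
    · intro b c
      rw [hG e (mem_insert_self _ _)]
      congr 1
      refine prod_congr rfl fun e' he' => ?_
      rw [Function.update_of_ne (ne_of_mem_of_not_mem he' he)]

end Bits

/-! ### Inequalities for likelihood ratios -/

/-- A pointwise substitute for Pinsker's inequality: when L has mean one, the right side averages to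
8 times the divergence plus 1/8. Write L - 1 = (√L - 1)(√L + 1), apply AM-GM, and bound the
Hellinger term (√L - 1)² by L - 1 - log L. -/
lemma sub_one_mul_le {L φ : ℝ} (hL : 0 < L) (h0 : 0 ≤ φ) (h1 : φ ≤ 1) :
    (L - 1) * φ ≤ 8 * (L - 1 - Real.log L) + (L + 1) / 16 := by
  have hs : 0 < √L := Real.sqrt_pos.2 hL
  have hsq : √L * √L = L := Real.mul_self_sqrt hL.le
  have hlog : Real.log √L ≤ √L - 1 := Real.log_le_sub_one_of_pos hs
  rw [Real.log_sqrt hL.le] at hlog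
  have h2 : (√L - 1) ^ 2 ≤ L - 1 - Real.log L := by nlinarith
  have h3 : (√L + 1) ^ 2 ≤ 2 * (L + 1) := by nlinarith [sq_nonneg (√L - 1)]
  have h4 : (L - 1) * φ ≤ 8 * (√L - 1) ^ 2 + (√L + 1) ^ 2 / 32 := by
    have : L - 1 = (√L - 1) * (√L + 1) := by linarith
    rw [this]
    have hφ : φ ^ 2 ≤ 1 := by nlinarith
    nlinarith [sq_nonneg (8 * (√L - 1) - (√L + 1) * φ / 2), sq_nonneg (√L + 1),
      mul_le_mul_of_nonneg_left hφ (sq_nonneg (√L + 1))]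
  linarith

/-- The divergence of a fair bit from a tilted one is at most δ²: the two logarithms add up to log(1
- δ²). -/
lemma neg_log_tilt_le {δ : ℝ} (h0 : 0 ≤ δ) (h1 : δ ≤ 1 / 2) :
    -δ ^ 2 ≤ (Real.log (tilt δ true) + Real.log (tilt δ false)) / 2 := by
  have hx : 0 < 1 - δ ^ 2 := by nlinarith
  have : Real.log (tilt δ true) + Real.log (tilt δ false) = Real.log (1 - δ ^ 2) := by
    rw [← Real.log_mul (tilt_pos h0 (by linarith) _).ne' (tilt_pos h0 (by linarith) _).ne']
    congr 1
    simp [tilt]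
    ring
  rw [this]
  have h := Real.one_sub_inv_le_log_of_pos hx
  have : (1 - δ ^ 2)⁻¹ ≤ 1 + 2 * δ ^ 2 := by
    rw [inv_le_iff_one_le_mul₀ hx]
    have hx4 : δ ^ 2 ≤ 1 / 4 := by nlinarith
    nlinarith [mul_nonneg (sq_nonneg δ) (sub_nonneg.2 hx4)]
  linarith

/-! ### Random environments with one slightly better action -/

section Environment

variable {K : Type*} [DecidableEq K] {T : ℕ}

/-- The losses given by random bits: a bit for each action in `U`, and `1` outside of `U`. -/
def bitLoss (U : Finset K) (b : Fin T × K → Bool) (t : ℕ) (j : K) : ℝ :=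
  if j ∈ U then if ht : t < T then (if b (⟨t, ht⟩, j) then 1 else 0) else 0 else 1

lemma bitLoss_mem_Icc (U : Finset K) (b : Fin T × K → Bool) (t : ℕ) (j : K) :
    bitLoss U b t j ∈ Set.Icc (0 : ℝ) 1 := by
  unfold bitLoss
  split_ifs <;> simp

lemma bitLoss_update_of_ne (U : Finset K) (b : Fin T × K → Bool) (t : Fin T) (i : K) (c : Bool)
    (r : ℕ) (j : K) (h : r ≠ t ∨ j ≠ i) :
    bitLoss U (Function.update b (t, i) c) r j = bitLoss U b r j := by
  have hne : ∀ hr : r < T, ((⟨r, hr⟩, j) : Fin T × K) ≠ (t, i) := by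
    intro hr he
    rw [Prod.mk.injEq] at he
    rcases h with h | h
    · exact h (by rw [← he.1])
    · exact h he.2
  simp only [bitLoss, Function.update_of_ne (hne _)]

variable [Fintype K]

/-- The density of the bits in the environment where action `i` is better by `δ / 2`. -/
def envDensity (δ : ℝ) (i : K) (b : Fin T × K → Bool) : ℝ :=
  ∏ e ∈ univ.filter (fun e : Fin T × K => e.2 = i), tilt δ (b e)

/-- The mean losses in the environment where action `i` is better by `δ / 2`. -/
def meanLoss (U : Finset K) (δ : ℝ) (i j : K) : ℝ :=
  if j ∈ U then if j = i then (1 - δ) / 2 else 1 / 2 else 1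

lemma envDensity_nonneg {δ : ℝ} (h0 : 0 ≤ δ) (h1 : δ < 1) (i : K) (b : Fin T × K → Bool) :
    0 ≤ envDensity δ i b := prod_nonneg fun _ _ => (tilt_pos h0 h1 _).le

lemma expect_envDensity (δ : ℝ) (i : K) : 𝔼 b : Fin T × K → Bool, envDensity δ i b = 1 := by
  have := expect_prod_tilt_mul δ (univ.filter (fun e : Fin T × K => e.2 = i)) (fun _ => 1)
    (fun _ _ _ _ => rfl)
  simpa [envDensity] using this

lemma expect_envDensity_mul_bitLoss (U : Finset K) (δ : ℝ) (i : K) (t : Fin T) (j : K)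
    (G : (Fin T × K → Bool) → ℝ) (hG : ∀ b c, G (Function.update b (t, j) c) = G b) :
    𝔼 b, envDensity δ i b * (G b * bitLoss U b t j) =
      (𝔼 b, envDensity δ i b * G b) * meanLoss U δ i j := by
  by_cases hj : j ∈ U
  swap
  · simp [bitLoss, meanLoss, hj]
  have hbit : ∀ b, bitLoss U b t j = (fun c : Bool => if c then (1 : ℝ) else 0) (b (t, j)) := by
    simp [bitLoss, hj]
  simp only [hbit]
  by_cases hji : j = i
  · subst hji
    set D := (univ.filter (fun e : Fin T × K => e.2 = j)).erase (t, j) with hD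
    have hden : ∀ b : Fin T × K → Bool,
        envDensity δ j b = tilt δ (b (t, j)) * ∏ e ∈ D, tilt δ (b e) := fun b =>
      (mul_prod_erase _ _ (by simp)).symm
    have hinv : ∀ b c, (∏ e ∈ D, tilt δ (Function.update b (t, j) c e)) *
        G (Function.update b (t, j) c) = (∏ e ∈ D, tilt δ (b e)) * G b := by
      intro b c
      rw [hG]
      congr 1
      refine prod_congr rfl fun e he => ?_
      rw [Function.update_of_ne (ne_of_mem_erase he)]
    have e1 := expect_mul_bit (t, j) (fun c => tilt δ c * if c then (1 : ℝ) else 0)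
      (fun b => (∏ e ∈ D, tilt δ (b e)) * G b) hinv
    have e2 := expect_mul_bit (t, j) (tilt δ) (fun b => (∏ e ∈ D, tilt δ (b e)) * G b) hinv
    have l1 : 𝔼 b : Fin T × K → Bool,
        envDensity δ j b * (G b * if b (t, j) then (1 : ℝ) else 0) =
        𝔼 b : Fin T × K → Bool, (tilt δ (b (t, j)) * if b (t, j) then (1 : ℝ) else 0) *
          ((∏ e ∈ D, tilt δ (b e)) * G b) :=
      expect_congr rfl fun b _ => by rw [hden]; ring
    have l2 : 𝔼 b : Fin T × K → Bool, envDensity δ j b * G b =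
        𝔼 b : Fin T × K → Bool, tilt δ (b (t, j)) * ((∏ e ∈ D, tilt δ (b e)) * G b) :=
      expect_congr rfl fun b _ => by rw [hden]; ring
    rw [l1, l2, e1, e2]
    simp [tilt, meanLoss, hj]
    ring
  · have hinv : ∀ b c, envDensity δ i (Function.update b (t, j) c) *
        G (Function.update b (t, j) c) = envDensity δ i b * G b := by
      intro b c
      rw [hG]
      congr 1
      refine prod_congr rfl fun e he => ?_
      rw [Function.update_of_ne]
      rintro rfl
      exact hji (by simpa using he)
    have e1 := expect_mul_bit (t, j) (fun c => if c then (1 : ℝ) else 0)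
      (fun b => envDensity δ i b * G b) hinv
    have l1 : 𝔼 b : Fin T × K → Bool,
        envDensity δ i b * (G b * if b (t, j) then (1 : ℝ) else 0) =
        𝔼 b : Fin T × K → Bool, (if b (t, j) then (1 : ℝ) else 0) * (envDensity δ i b * G b) :=
      expect_congr rfl fun b _ => by ring
    rw [l1, e1]
    simp [meanLoss, hj, hji]
    ring

variable {F : SimpleGraph K} {f : ℕ} {p : Policy K}

lemma playRate_bitLoss_update (hp : p.IsLocal F f) (q : ℝ) (U : Finset K) (t : Fin T) (i : K)
    (j : K) (b : Fin T × K → Bool) (c : Bool) :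
    playRate p q (bitLoss U (Function.update b (t, i) c)) t j = playRate p q (bitLoss U b) t j :=
  playRate_congr hp q (fun r hr => funext fun k =>
    bitLoss_update_of_ne U b t i c r k (Or.inl hr.ne)) j

/-- The probability that action `j` is played in round `t`, in the environment of `i`. -/
def envRate (p : Policy K) (q : ℝ) (U : Finset K) (δ : ℝ) (i : K) (t : Fin T) (j : K) : ℝ :=
  𝔼 b : Fin T × K → Bool, envDensity δ i b * playRate p q (bitLoss U b) t j

lemma envRate_nonneg (p : Policy K) {q : ℝ} (h0 : 0 ≤ q) (h1 : q ≤ 1) (U : Finset K) {δ : ℝ}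
    (hδ0 : 0 ≤ δ) (hδ1 : δ < 1) (i : K) (t : Fin T) (j : K) : 0 ≤ envRate p q U δ i t j :=
  expect_nonneg fun b _ => mul_nonneg (envDensity_nonneg hδ0 hδ1 i b)
    (playRate_nonneg p h0 h1 _ _ _)

lemma sum_envRate (hp : p.IsLocal F f) (q : ℝ) (U : Finset K) (δ : ℝ) (i : K) (t : Fin T) :
    ∑ j, envRate p q U δ i t j = q := by
  simp only [envRate]
  rw [← expect_sum_comm]
  simp only [← mul_sum, sum_playRate hp, ← expect_mul, expect_envDensity, one_mul]

lemma envRate_zero (p : Policy K) (q : ℝ) (U : Finset K) (i : K) (t : Fin T) (j : K) :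
    envRate p q U 0 i t j = 𝔼 b : Fin T × K → Bool, playRate p q (bitLoss U b) t j := by
  simp [envRate, envDensity, tilt]

lemma expect_envDensity_mul_runRegret (hp : p.IsLocal F f) (q : ℝ) (U : Finset K) (δ : ℝ) (i : K) :
    𝔼 b : Fin T × K → Bool, envDensity δ i b * runRegret p q (bitLoss U b) T i =
      ∑ t : Fin T, ∑ j, envRate p q U δ i t j * (meanLoss U δ i j - meanLoss U δ i i) := by
  simp only [runRegret_eq hp, mul_sum]
  rw [expect_sum_comm]
  refine sum_congr rfl fun t _ => ?_
  rw [expect_sum_comm]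
  refine sum_congr rfl fun j _ => ?_
  rw [mul_sub, envRate,
    ← expect_envDensity_mul_bitLoss U δ i t j _ fun b c => playRate_bitLoss_update hp q U t j j b c,
    ← expect_envDensity_mul_bitLoss U δ i t i _ fun b c => playRate_bitLoss_update hp q U t i j b c,
    ← expect_sub_distrib]
  exact expect_congr rfl fun b _ => by ring

lemma le_expect_runRegret (hp : p.IsLocal F f) {q : ℝ} (h0 : 0 ≤ q) (h1 : q ≤ 1) {U : Finset K}
    {δ : ℝ} (hδ0 : 0 ≤ δ) (hδ1 : δ < 1) {i : K} (hi : i ∈ U) :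
    δ / 2 * ∑ t : Fin T, (q - envRate p q U δ i t i) ≤
      𝔼 b : Fin T × K → Bool, envDensity δ i b * runRegret p q (bitLoss U b) T i := by
  rw [expect_envDensity_mul_runRegret hp, mul_sum]
  refine sum_le_sum fun t _ => ?_
  have hsum : q - envRate p q U δ i t i = ∑ j ∈ univ.erase i, envRate p q U δ i t j := by
    rw [sum_erase_eq_sub (mem_univ i), sum_envRate hp]
  rw [hsum, mul_sum, ← sum_erase_add _ _ (mem_univ i), sub_self, mul_zero, add_zero]
  refine sum_le_sum fun j hj => ?_
  rw [mul_comm]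
  refine mul_le_mul_of_nonneg_left ?_ (envRate_nonneg p h0 h1 U hδ0 hδ1 i t j)
  simp only [meanLoss, hi, if_true, ne_of_mem_erase hj, if_false]
  split_ifs <;> linarith

/-- Under fair bits all actions of `U` have mean 1/2, so exactly the plays outside `U` cost an extra
1/2. -/
lemma le_expect_runRegret_zero (hp : p.IsLocal F f) (q : ℝ)
    {U : Finset K} {i : K} (hi : i ∈ U) :
    1 / 2 * ∑ t : Fin T, ∑ j ∈ Uᶜ, envRate p q U 0 i t j ≤
      𝔼 b : Fin T × K → Bool, runRegret p q (bitLoss U b) T i := by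
  have := expect_envDensity_mul_runRegret (T := T) hp q U 0 i
  have h : ∀ b : Fin T × K → Bool, envDensity 0 i b = 1 := by simp [envDensity, tilt]
  simp only [h, one_mul] at this
  rw [this, mul_sum]
  refine sum_le_sum fun t _ => ?_
  rw [← sum_add_sum_compl U, mul_sum]
  have hU : ∑ j ∈ U, envRate p q U 0 i t j * (meanLoss U 0 i j - meanLoss U 0 i i) = 0 :=
    sum_eq_zero fun j hj => by simp [meanLoss, hi, hj]
  rw [hU, zero_add]
  refine sum_le_sum fun j hj => ?_
  have hj' : j ∉ U := by simpa using hj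
  simp only [meanLoss, hi, hj', if_true, if_false]
  linarith

/-! ### Change of measure -/

open scoped Classical in
/-- The probability that the loss of `i` in round `t` is revealed, when all bits are fair. -/
def revealRate (F : SimpleGraph K) (f : ℕ) (p : Policy K) (q : ℝ) (U : Finset K) (i : K)
    (t : Fin T) : ℝ :=
  ∑ j with F.edist i j ≤ f, envRate p q U 0 i t j

open scoped Classical in
/-- The rounds in which the moves `y` reveal the loss of `i`. -/
def revealed (F : SimpleGraph K) (f : ℕ) (i : K) (y : Fin T → Option K) : Finset (Fin T) :=
  {t | ∃ j, y t = some j ∧ F.edist i j ≤ f}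

lemma policy_bitLoss_update (hp : p.IsLocal F f) (U : Finset K) {t : Fin T} {i : K}
    {y : Fin T → Option K} (ht : t ∉ revealed F f i y) (b : Fin T × K → Bool) (c : Bool) (s : ℕ) :
    p s (extendRun y) (bitLoss U (Function.update b (t, i) c)) =
        p s (extendRun y) (bitLoss U b) := by
  refine hp s _ _ _ _ (fun _ _ => rfl) fun r hr k j hj hkj => ?_
  apply bitLoss_update_of_ne
  by_contra! hcon
  obtain ⟨rfl, rfl⟩ := hcon
  rw [extendRun_apply] at hj
  exact ht (by simpa [revealed] using ⟨j, hj, hkj⟩)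

/-- Only the revealed bits matter for the change of environment. -/
lemma expect_envDensity_mul_eq (hp : p.IsLocal F f) (q : ℝ) (U : Finset K) (δ : ℝ) (i : K)
    (y : Fin T → Option K) (g : stdSimplex ℝ K → ℝ) (t : ℕ) :
    𝔼 b : Fin T × K → Bool, envDensity δ i b *
        (runProb p q (bitLoss U b) y * g (p t (extendRun y) (bitLoss U b))) =
      𝔼 b : Fin T × K → Bool, (∏ s ∈ revealed F f i y, tilt δ (b (s, i))) *
        (runProb p q (bitLoss U b) y * g (p t (extendRun y) (bitLoss U b))) := by
  classical
  have himg : univ.filter (fun e : Fin T × K => e.2 = i) =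
      univ.image (fun s : Fin T => (s, i)) := by
    ext ⟨s, k⟩
    simp [eq_comm]
  have hinj : Set.InjOn (fun s : Fin T => (s, i)) (↑(univ : Finset (Fin T)) : Set (Fin T)) :=
    fun s _ s' _ h => (Prod.mk.inj h).1
  have hden : ∀ b : Fin T × K → Bool, envDensity δ i b =
      (∏ e ∈ (revealed F f i y)ᶜ.image (fun s : Fin T => (s, i)), tilt δ (b e)) *
        ∏ s ∈ revealed F f i y, tilt δ (b (s, i)) := by
    intro b
    rw [envDensity, himg, prod_image hinj, prod_image (hinj.mono (by simp)), mul_comm,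
      prod_mul_prod_compl]
  simp only [hden, mul_assoc]
  -- Along the fixed run `y` the policy never sees the unrevealed bits of `i`, so their tilts
  -- average to one.
  rw [expect_prod_tilt_mul]
  intro e he b c
  obtain ⟨s, hs, rfl⟩ := mem_image.1 he
  rw [mem_compl] at hs
  have h1 := policy_bitLoss_update hp U hs b c
  simp only [runProb, h1]
  congr 1
  refine prod_congr rfl fun s' hs' => ?_
  rw [Function.update_of_ne]
  rintro h
  exact hs ((Prod.mk.inj h).1 ▸ hs')

/-- Whether round t reveals the bit (t, i) is independent of that bit, so each revelation
contributes the fair mean of the log-tilt. -/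
lemma expect_sum_log_tilt (hp : p.IsLocal F f) (q : ℝ) (U : Finset K) (δ : ℝ) (i : K) :
    𝔼 b : Fin T × K → Bool, ∑ y : Fin T → Option K, runProb p q (bitLoss U b) y *
        ∑ s ∈ revealed F f i y, Real.log (tilt δ (b (s, i))) =
      (Real.log (tilt δ true) + Real.log (tilt δ false)) / 2 *
        ∑ t : Fin T, revealRate F f p q U i t := by
  classical
  have h1 : ∀ b : Fin T × K → Bool, ∑ y : Fin T → Option K, runProb p q (bitLoss U b) y *
        ∑ s ∈ revealed F f i y, Real.log (tilt δ (b (s, i))) =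
      ∑ t : Fin T, Real.log (tilt δ (b (t, i))) *
        ∑ j with F.edist i j ≤ f, playRate p q (bitLoss U b) t j := by
    intro b
    have h2 : ∀ t : Fin T, ∑ j with F.edist i j ≤ f, playRate p q (bitLoss U b) t j =
        ∑ y : Fin T → Option K, runProb p q (bitLoss U b) y *
          if t ∈ revealed F f i y then 1 else 0 := by
      intro t
      have := sum_runProb_mul_move hp q (bitLoss U b) t
        (fun o => if ∃ j, o = some j ∧ F.edist i j ≤ f then 1 else 0) (by simp)
      simp only [revealed, mem_filter, mem_univ, true_and]
      rw [this]
      simp [sum_filter]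
    simp only [h2, mul_sum]
    rw [sum_comm]
    refine sum_congr rfl fun y _ => ?_
    rw [← sum_filter_add_sum_filter_not univ (fun s => s ∈ revealed F f i y)]
    rw [sum_eq_zero (s := univ.filter fun s => s ∉ revealed F f i y), add_zero]
    · rw [filter_mem_eq_inter, univ_inter]
      exact sum_congr rfl fun s hs => by simp [hs, mul_comm]
    · intro s hs
      simp [(mem_filter.1 hs).2]
  simp only [h1]
  rw [expect_sum_comm, mul_sum]
  refine sum_congr rfl fun t _ => ?_
  rw [expect_mul_bit (t, i) (fun c => Real.log (tilt δ c))]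
  · simp only [revealRate, envRate_zero]
    rw [expect_sum_comm]
  · intro b c
    exact sum_congr rfl fun j _ => playRate_bitLoss_update hp q U t i j b c

/-- The change of measure has likelihood ratio `L`, the product of the tilts of the revealed bits.
`sub_one_mul_le` is averaged under fair bits, where `L` has mean one and -log `L` has mean at most
δ² times the expected number of revelations. -/
lemma envRate_le (hp : p.IsLocal F f) {q : ℝ} (h0 : 0 ≤ q) (h1 : q ≤ 1) (U : Finset K) {δ : ℝ}
    (hδ0 : 0 ≤ δ) (hδ1 : δ ≤ 1 / 2) (i : K) (t : Fin T) (j : K) :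
    envRate p q U δ i t j ≤ envRate p q U 0 i t j +
      q * (8 * δ ^ 2 * ∑ s : Fin T, revealRate F f p q U i s + 1 / 8) := by
  classical
  set L : (Fin T × K → Bool) → (Fin T → Option K) → ℝ :=
    fun b y => ∏ s ∈ revealed F f i y, tilt δ (b (s, i)) with hL
  have hLpos : ∀ b y, 0 < L b y := fun b y => prod_pos fun s _ => tilt_pos hδ0 (by linarith) _
  have hcm : ∀ g : stdSimplex ℝ K → ℝ, 𝔼 b : Fin T × K → Bool, envDensity δ i b *
      ∑ y : Fin T → Option K, runProb p q (bitLoss U b) y * g (p t (extendRun y) (bitLoss U b)) =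
      𝔼 b : Fin T × K → Bool, ∑ y : Fin T → Option K, runProb p q (bitLoss U b) y *
        (L b y * g (p t (extendRun y) (bitLoss U b))) := by
    intro g
    simp only [mul_sum]
    rw [expect_sum_comm, expect_sum_comm]
    refine sum_congr rfl fun y _ => ?_
    rw [expect_envDensity_mul_eq hp]
    exact expect_congr rfl fun b _ => by simp only [hL]; ring
  have hone : 𝔼 b : Fin T × K → Bool, ∑ y : Fin T → Option K,
      runProb p q (bitLoss U b) y * L b y = 1 := by
    have := hcm fun _ => 1
    simp only [mul_one, sum_runProb hp, expect_envDensity] at this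
    exact this.symm
  have htot : 𝔼 b : Fin T × K → Bool, ∑ y : Fin T → Option K,
      runProb p q (bitLoss U b) y = 1 := by
    simp only [sum_runProb hp, expect_const univ_nonempty]
  have hlog : 𝔼 b : Fin T × K → Bool, ∑ y : Fin T → Option K,
      runProb p q (bitLoss U b) y * Real.log (L b y) =
      (Real.log (tilt δ true) + Real.log (tilt δ false)) / 2 *
        ∑ t : Fin T, revealRate F f p q U i t := by
    rw [← expect_sum_log_tilt hp]
    refine expect_congr rfl fun b _ => sum_congr rfl fun y _ => ?_
    rw [Real.log_prod fun s _ => (tilt_pos hδ0 (by linarith) _).ne']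
  have hpt : 𝔼 b : Fin T × K → Bool, ∑ y : Fin T → Option K, runProb p q (bitLoss U b) y *
        ((L b y - 1) * p t (extendRun y) (bitLoss U b) j) ≤
      𝔼 b : Fin T × K → Bool, ∑ y : Fin T → Option K, runProb p q (bitLoss U b) y *
        (8 * (L b y - 1 - Real.log (L b y)) + (L b y + 1) / 16) := by
    refine expect_le_expect fun b _ => sum_le_sum fun y _ =>
      mul_le_mul_of_nonneg_left ?_ (runProb_nonneg p h0 h1 _ y)
    have hs : ∑ k, p t (extendRun y) (bitLoss U b) k = 1 := (p _ _ _).2.2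
    refine sub_one_mul_le (hLpos b y) ((p _ _ _).2.1 j) ?_
    rw [← hs]
    exact single_le_sum (fun k _ => (p t (extendRun y) (bitLoss U b)).2.1 k) (mem_univ j)
  have hr : 𝔼 b : Fin T × K → Bool, ∑ y : Fin T → Option K, runProb p q (bitLoss U b) y *
        (8 * (L b y - 1 - Real.log (L b y)) + (L b y + 1) / 16) =
      8 * (1 - 1 - (Real.log (tilt δ true) + Real.log (tilt δ false)) / 2 *
        ∑ t : Fin T, revealRate F f p q U i t) + (1 + 1) / 16 := by
    conv_rhs => rw [← hlog]
    conv_rhs =>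
      enter [2, 1, 1]
      rw [← hone]
    conv_rhs =>
      enter [1, 2, 1, 1]
      rw [← hone]
    conv_rhs =>
      enter [1, 2, 1, 2]
      rw [← htot]
    conv_rhs =>
      enter [2, 1, 2]
      rw [← htot]
    rw [← expect_sub_distrib, ← expect_sub_distrib, ← expect_add_distrib, mul_expect, expect_div,
      ← expect_add_distrib]
    refine expect_congr rfl fun b _ => ?_
    rw [← sum_sub_distrib, ← sum_sub_distrib, ← sum_add_distrib, mul_sum, sum_div,
      ← sum_add_distrib]
    exact sum_congr rfl fun y _ => by ring
  have hl : q * 𝔼 b : Fin T × K → Bool, ∑ y : Fin T → Option K, runProb p q (bitLoss U b) y *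
        ((L b y - 1) * p t (extendRun y) (bitLoss U b) j) =
      envRate p q U δ i t j - envRate p q U 0 i t j := by
    rw [envRate_zero, envRate]
    simp only [playRate_eq_sum hp]
    have := hcm fun x => x j
    simp only [mul_left_comm _ q, ← mul_expect]
    rw [this, ← mul_sub, ← expect_sub_distrib]
    congr 1
    refine expect_congr rfl fun b _ => ?_
    rw [← sum_sub_distrib]
    exact sum_congr rfl fun y _ => by ring
  have hrev : 0 ≤ ∑ s : Fin T, revealRate F f p q U i s :=
    sum_nonneg fun s _ => sum_nonneg fun j _ =>
      envRate_nonneg p h0 h1 U le_rfl zero_lt_one i s j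
  have hk := mul_le_mul_of_nonneg_right (neg_log_tilt_le hδ0 hδ1) hrev
  have := mul_le_mul_of_nonneg_left (hpt.trans_eq hr) h0
  rw [hl] at this
  have h3 : q * (8 * (1 - 1 - (Real.log (tilt δ true) + Real.log (tilt δ false)) / 2 *
        ∑ t : Fin T, revealRate F f p q U i t) + (1 + 1) / 16) ≤
      q * (8 * δ ^ 2 * ∑ s : Fin T, revealRate F f p q U i s + 1 / 8) :=
    mul_le_mul_of_nonneg_left (by linarith) h0
  linarith

end Environment

/-! ### One agent, summed over the environments -/

section SingleAgent

variable {K : Type*} [Fintype K] [DecidableEq K] {F : SimpleGraph K} {f : ℕ} {p : Policy K}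

/-- The expected number of plays outside of `U`, when all bits are fair. -/
def offRate (p : Policy K) (q : ℝ) (U : Finset K) (T : ℕ) : ℝ :=
  ∑ t : Fin T, ∑ j ∈ Uᶜ, 𝔼 b : Fin T × K → Bool, playRate p q (bitLoss U b) t j

lemma offRate_nonneg (p : Policy K) {q : ℝ} (h0 : 0 ≤ q) (h1 : q ≤ 1) (U : Finset K) (T : ℕ) :
    0 ≤ offRate p q U T :=
  sum_nonneg fun _ _ => sum_nonneg fun _ _ => expect_nonneg fun _ _ => playRate_nonneg p h0 h1 _ _ _

open scoped Classical in
-- Double counting: a play in `U` reveals at most two actions of `U`, any other play at most all of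
-- them.
lemma sum_revealRate_le (hp : p.IsLocal F f) {q : ℝ} (h0 : 0 ≤ q) (h1 : q ≤ 1) (T : ℕ)
    {U : Finset K} (hU : ∀ j ∈ U, #{i ∈ U | F.edist i j ≤ f} ≤ 2) :
    ∑ i ∈ U, ∑ t : Fin T, revealRate F f p q U i t ≤ 2 * (q * T) + #U * offRate p q U T := by
  set r : Fin T → K → ℝ := fun t j => 𝔼 b : Fin T × K → Bool, playRate p q (bitLoss U b) t j with hr
  have hr0 : ∀ t j, 0 ≤ r t j := fun t j => expect_nonneg fun _ _ => playRate_nonneg p h0 h1 _ _ _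
  have hrU : ∀ t, ∑ j ∈ U, r t j ≤ q := by
    intro t
    have := sum_envRate (T := T) hp q U 0
    rcases U.eq_empty_or_nonempty with rfl | ⟨i, hi⟩
    · simpa using h0
    · rw [← this i t]
      simp only [envRate_zero]
      exact sum_le_sum_of_subset_of_nonneg (subset_univ _) fun j _ _ => hr0 t j
  rw [sum_comm, offRate, mul_sum]
  have hT : 2 * (q * T) = ∑ _t : Fin T, 2 * q := by simp; ring
  rw [hT, ← sum_add_distrib]
  refine sum_le_sum fun t _ => ?_
  have h : ∑ i ∈ U, revealRate F f p q U i t =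
      ∑ j, (#{i ∈ U | F.edist i j ≤ f} : ℝ) * r t j := by
    simp only [revealRate, envRate_zero, sum_filter]
    rw [sum_comm]
    refine sum_congr rfl fun j _ => ?_
    rw [← sum_filter, sum_const, nsmul_eq_mul]
  rw [h, ← sum_add_sum_compl U]
  refine add_le_add ?_ ?_
  · refine le_trans ?_ (mul_le_mul_of_nonneg_left (hrU t) zero_le_two)
    rw [mul_sum]
    refine sum_le_sum fun j hj => mul_le_mul_of_nonneg_right ?_ (hr0 t j)
    exact_mod_cast hU j hj
  · rw [mul_sum]
    refine sum_le_sum fun j _ => mul_le_mul_of_nonneg_right ?_ (hr0 t j)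
    exact_mod_cast card_filter_le _ _

open scoped Classical in
-- Under fair bits the rates of playing `i`, summed over `i ∈ U`, total at most `q * T`, which gives
-- the -1; the slack 1/8 of `envRate_le` in each environment turns `#U` into 7/8 of it.
lemma le_sum_expect_runRegret (hp : p.IsLocal F f) {q : ℝ} (h0 : 0 ≤ q) (h1 : q ≤ 1) (T : ℕ)
    {U : Finset K} (hU : ∀ j ∈ U, #{i ∈ U | F.edist i j ≤ f} ≤ 2) {δ : ℝ} (hδ0 : 0 ≤ δ)
    (hδ1 : δ ≤ 1 / 2) :
    δ / 2 * (q * T * (7 / 8 * #U - 1 - 8 * δ ^ 2 * (2 * (q * T) + #U * offRate p q U T))) ≤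
      ∑ i ∈ U, 𝔼 b : Fin T × K → Bool, envDensity δ i b * runRegret p q (bitLoss U b) T i := by
  refine le_trans ?_ (sum_le_sum fun i hi =>
    le_expect_runRegret (T := T) hp h0 h1 hδ0 (by linarith) hi)
  rw [← mul_sum]
  refine mul_le_mul_of_nonneg_left ?_ (by linarith)
  have hone : ∑ i ∈ U, ∑ t : Fin T, envRate p q U 0 i t i ≤ q * T := by
    rw [sum_comm]
    have hT : q * T = ∑ _t : Fin T, q := by simp; ring
    rw [hT]
    refine sum_le_sum fun t _ => ?_
    rcases U.eq_empty_or_nonempty with rfl | ⟨i, hi⟩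
    · simpa using h0
    · refine le_of_le_of_eq ?_ (sum_envRate hp q U 0 i t)
      simp only [envRate_zero]
      exact sum_le_sum_of_subset_of_nonneg (subset_univ _) fun j _ _ =>
        expect_nonneg fun _ _ => playRate_nonneg p h0 h1 _ _ _
  have hsum : ∑ i ∈ U, ∑ t : Fin T, (q - (envRate p q U 0 i t i +
      q * (8 * δ ^ 2 * ∑ s : Fin T, revealRate F f p q U i s + 1 / 8))) ≤
      ∑ i ∈ U, ∑ t : Fin T, (q - envRate p q U δ i t i) :=
    sum_le_sum fun i _ => sum_le_sum fun t _ => sub_le_sub_left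
      (envRate_le hp h0 h1 U hδ0 hδ1 i t i) _
  refine le_trans ?_ hsum
  have hrev := sum_revealRate_le hp h0 h1 T hU
  simp only [sum_sub_distrib, sum_add_distrib, ← mul_sum, sum_const, card_univ, Fintype.card_fin,
    nsmul_eq_mul]
  have hqT : 0 ≤ q * T := by positivity
  have h3 := mul_le_mul_of_nonneg_left hrev (mul_nonneg hqT (by positivity : 0 ≤ 8 * δ ^ 2))
  nlinarith

end SingleAgent

/-! ### Isolated agents -/

section Agents

variable {A K : Type*} [Fintype K]

/-- Every message reaching `v` is its own, and the distributions inside are handled by induction on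
the round. The feedback delays are simply forgotten, which only gives the agent more information. -/
lemma actionDist_congr (N : SimpleGraph A) (n : ℕ) (F : SimpleGraph K) (f : ℕ) (σ : Strategy A K)
    (q : A → ℝ) {v : A} (hv : ∀ u, 0 < q u → N.edist u v ≤ n → u = v) (t : ℕ) (h h' : Play A K)
    (ℓ ℓ' : ℕ → K → ℝ) (hh : ∀ r < t, h r v = h' r v)
    (hℓ : ∀ r < t, ∀ i j, h r v = some j → F.edist i j ≤ f → ℓ r i = ℓ' r i) :
    actionDist N n F f σ q ℓ h t v = actionDist N n F f σ q ℓ' h' t v := by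
  induction t using Nat.strong_induction_on with
  | _ t ih =>
  rw [actionDist, actionDist]
  congr 1
  funext s u
  split_ifs with hs
  swap
  · rfl
  obtain ⟨hst, -, hn, hq⟩ := hs
  obtain rfl := hv u hq hn
  rw [ih s hst (fun r hr => hh r (hr.trans hst)) fun r hr => hℓ r (hr.trans hst)]
  congr 2
  ext x
  constructor
  · rintro ⟨a, r, i, j, ha, hr, hj, hd, rfl⟩
    refine ⟨a, r, i, j, ha, hr, by rw [← hh r (by omega), hj], hd, ?_⟩
    rw [hℓ r (by omega) i j hj (by rw [hd]; exact_mod_cast ha)]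
  · rintro ⟨a, r, i, j, ha, hr, hj, hd, rfl⟩
    rw [← hh r (by omega)] at hj
    refine ⟨a, r, i, j, ha, hr, hj, hd, ?_⟩
    rw [hℓ r (by omega) i j hj (by rw [hd]; exact_mod_cast ha)]

open scoped Classical in
/-- The policy of an isolated agent; agents that do not take part get a constant policy. -/
def agentPolicy (N : SimpleGraph A) (n : ℕ) (F : SimpleGraph K) (f : ℕ) (σ : Strategy A K)
    (q : A → ℝ) (v : A) : Policy K := fun t y ℓ =>
  -- An agent that does not take part may hear several active ones, so its prescribed distribution
  -- need not be local; as it never plays, any constant will do.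
  if 0 < q v then actionDist N n F f σ q ℓ (fun r _ => y r) t v else σ q 0 v fun _ _ => none

variable {N : SimpleGraph A} {n : ℕ} {q : A → ℝ}

lemma agentPolicy_isLocal (hiso : ∀ u v, 0 < q u → 0 < q v → N.edist u v ≤ n → u = v)
    (F : SimpleGraph K) (f : ℕ) (σ : Strategy A K) (v : A) :
    (agentPolicy N n F f σ q v).IsLocal F f := by
  intro t h h' ℓ ℓ' hh hℓ
  unfold agentPolicy
  split_ifs with hq
  · exact actionDist_congr N n F f σ q (fun u hu => hiso u v hu hq) t _ _ ℓ ℓ' hh hℓ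
  · rfl

variable [Fintype A]

lemma playProb_eq_prod (hiso : ∀ u v, 0 < q u → 0 < q v → N.edist u v ≤ n → u = v)
    (hq : ∀ v, 0 ≤ q v) (F : SimpleGraph K) (f : ℕ) (σ : Strategy A K) (ℓ : ℕ → K → ℝ) {T : ℕ}
    (x : Fin T → A → Option K) :
    playProb N n F f σ q ℓ x =
      ∏ v, runProb (agentPolicy N n F f σ q v) (q v) ℓ fun t => x t v := by
  simp only [playProb, runProb]
  rw [prod_comm]
  refine prod_congr rfl fun v _ => prod_congr rfl fun t _ => ?_
  rcases (hq v).eq_or_lt with h | h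
  · rw [← h]
    cases x t v <;> simp [moveProb]
  · simp only [agentPolicy, h, if_true]
    congr 1
    refine actionDist_congr N n F f σ q (fun u hu => hiso u v hu h) t _ _ ℓ ℓ (fun r hr => ?_)
      fun _ _ _ _ _ _ => rfl
    simp [extend, extendRun]

variable [DecidableEq A]

/-- In the product law the runs of all other agents sum to one. -/
lemma sum_playProb_mul (hiso : ∀ u v, 0 < q u → 0 < q v → N.edist u v ≤ n → u = v)
    (hq : ∀ v, 0 ≤ q v) (F : SimpleGraph K) (f : ℕ) (σ : Strategy A K) (ℓ : ℕ → K → ℝ) {T : ℕ}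
    (v : A) (g : (Fin T → Option K) → ℝ) :
    ∑ x : Fin T → A → Option K, playProb N n F f σ q ℓ x * g (fun t => x t v) =
      ∑ y : Fin T → Option K, runProb (agentPolicy N n F f σ q v) (q v) ℓ y * g y := by
  have h1 : ∀ x : Fin T → A → Option K, playProb N n F f σ q ℓ x * g (fun t => x t v) =
      ∏ u, (fun (u : A) (y : Fin T → Option K) =>
        runProb (agentPolicy N n F f σ q u) (q u) ℓ y * if u = v then g y else 1) u
          (fun t => x t u) := by
    intro x
    rw [playProb_eq_prod hiso hq, prod_mul_distrib]
    simp
  simp only [h1]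
  rw [← (Equiv.piComm fun (_ : A) (_ : Fin T) => Option K).sum_comp]
  simp only [Equiv.piComm_apply, Function.swap]
  rw [← Fintype.prod_sum (fun (u : A) (y : Fin T → Option K) =>
        runProb (agentPolicy N n F f σ q u) (q u) ℓ y * if u = v then g y else 1),
    ← mul_prod_erase _ _ (mem_univ v), prod_eq_one, mul_one]
  · simp
  · intro u hu
    simp [ne_of_mem_erase hu, sum_runProb (agentPolicy_isLocal hiso F f σ u)]

lemma sum_runRegret_le_regret (hiso : ∀ u v, 0 < q u → 0 < q v → N.edist u v ≤ n → u = v)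
    (hq : ∀ v, 0 ≤ q v) (F : SimpleGraph K) (f : ℕ) (σ : Strategy A K) (ℓ : ℕ → K → ℝ) (T : ℕ)
    (i : K) :
    ∑ v, runRegret (agentPolicy N n F f σ q v) (q v) ℓ T i ≤ regret N n F f T σ q ℓ := by
  refine le_of_eq_of_le ?_ (le_ciSup (Set.finite_range _).bddAbove i)
  simp only [runRegret]
  simp only [← sum_playProb_mul hiso hq F f σ ℓ _ (fun y => ∑ t : Fin T,
    ((y t).elim 0 (ℓ t) - (y t).elim 0 fun _ => ℓ t i))]
  rw [sum_comm]
  refine sum_congr rfl fun x _ => ?_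
  rw [← mul_sum, sum_comm, ← sum_sub_distrib]
  congr 1
  refine sum_congr rfl fun t _ => ?_
  rw [sum_sub_distrib, chargedLoss, numActive, card_filter, Nat.cast_sum, sum_mul]
  congr 1
  refine sum_congr rfl fun v _ => ?_
  cases x t v <;> simp

end Agents

/-! ### The lower bound -/

lemma regret_bound_arith {m a Q T R B δ : ℝ} (hm : 2 ≤ m) (ha : 0 < a) (hQ : 0 < Q) (hT : 0 < T)
    (hδ : 0 ≤ δ) (hδ2 : δ ^ 2 = m * a / (128 * (Q * T))) (hmδ : m * δ ≤ 1) (hB : B ≤ 2 * R)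
    (hR0 : 0 ≤ R)
    (h : δ / 2 * (T * (Q * (7 / 8 * m - 1 - 8 * δ ^ 2 * (2 * (Q / a * T))) -
      8 * δ ^ 2 * m * (Q / a) * B)) ≤ m * R) :
    δ * (Q * T) / 16 ≤ R := by
  have e1 : δ ^ 2 * (Q / a * T) = m / 128 := by
    rw [hδ2]
    field_simp
  have e2 : δ / 2 * (T * (Q * (7 / 8 * m - 1 - 8 * δ ^ 2 * (2 * (Q / a * T))) -
      8 * δ ^ 2 * m * (Q / a) * B)) =
      δ / 2 * (Q * T * (7 / 8 * m - 1 - 16 * (δ ^ 2 * (Q / a * T)))) -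
        4 * m * δ * (δ ^ 2 * (Q / a * T)) * B := by ring
  rw [e2, e1] at h
  have hmpos : 0 < m := by linarith
  have hX : 0 ≤ δ * (Q * T) := by positivity
  -- Here 7/8 - 16/128 = 3/4, and 1 ≤ m/2.
  have h1 : m / 4 * (δ / 2 * (Q * T)) ≤ δ / 2 * (Q * T * (7 / 8 * m - 1 - 16 * (m / 128))) := by
    nlinarith
  have h2 : 4 * m * δ * (m / 128) * B ≤ m / 16 * R := by
    have e3 : 4 * m * δ * (m / 128) * B = m / 32 * (m * δ) * B := by ring
    rw [e3]
    have h0 : 0 ≤ m * δ := by positivity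
    have : m * δ * B ≤ 1 * (2 * R) :=
      (mul_le_mul_of_nonneg_left hB h0).trans (mul_le_mul_of_nonneg_right hmδ (by linarith))
    nlinarith
  have h3 : m * (δ * (Q * T) / 8) ≤ m * (17 / 16 * R) := by linarith
  have h4 := le_of_mul_le_mul_left h3 hmpos
  linarith

open scoped Classical in
lemma exists_losses_le_regret {A K : Type*} [Fintype A] [Fintype K]
    {N : SimpleGraph A} {n : ℕ} {q : A → ℝ}
    (hiso : ∀ u v, 0 < q u → 0 < q v → N.edist u v ≤ n → u = v) {a Q : ℝ} (ha : 1 ≤ a) (hQ : 0 < Q)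
    (hQa : Q ≤ a) (hq : ∀ v, q v = 0 ∨ q v = Q / a) (hqsum : ∑ v, q v = Q)
    (F : SimpleGraph K) (f : ℕ) (σ : Strategy A K) {T : ℕ}
    {U : Finset K} (h2 : 2 ≤ #U) (hU : ∀ j ∈ U, #{i ∈ U | F.edist i j ≤ f} ≤ 2)
    (hT : (#U : ℝ) ^ 3 * a ≤ 128 * (Q * T)) :
    ∃ ℓ : ℕ → K → ℝ, (∀ t i, ℓ t i ∈ Set.Icc (0 : ℝ) 1) ∧
      √(#U * a / (128 * (Q * T))) * (Q * T) / 16 ≤ regret N n F f T σ q ℓ := by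
  have ha0 : 0 < a := by linarith
  have hm : (2 : ℝ) ≤ #U := by exact_mod_cast h2
  have hQT : 0 < Q * T := by
    have : 0 < (#U : ℝ) ^ 3 * a := by positivity
    linarith
  have hTpos : (0 : ℝ) < T := pos_of_mul_pos_right hQT hQ.le
  have hQa0 : 0 ≤ Q / a := by positivity
  have hQa1 : Q / a ≤ 1 := (div_le_one ha0).2 hQa
  have hq0 : ∀ v, 0 ≤ q v := fun v => by rcases hq v with h | h <;> rw [h]; exact hQa0
  have hqa : ∀ v, q v ≤ Q / a := fun v => by rcases hq v with h | h <;> rw [h]; exact hQa0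
  have hq1 : ∀ v, q v ≤ 1 := fun v => (hqa v).trans hQa1
  have hloc := agentPolicy_isLocal (n := n) hiso F f σ
  set P := agentPolicy N n F f σ q with hP
  -- The worst bit sequence for `σ` dominates every density-weighted average, hence all environments
  -- at once.
  obtain ⟨b₀, hb₀⟩ := Finite.exists_max fun b : Fin T × K → Bool =>
    regret N n F f T σ q (bitLoss U b)
  refine ⟨bitLoss U b₀, bitLoss_mem_Icc U b₀, ?_⟩
  set R := regret N n F f T σ q (bitLoss U b₀) with hR
  -- With this δ, δ² times the expected number (Q/a)T of plays of an active agent equals #U/128.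
  set δ := √(#U * a / (128 * (Q * T))) with hδ
  have hδ0 : 0 ≤ δ := Real.sqrt_nonneg _
  have hδ2 : δ ^ 2 = #U * a / (128 * (Q * T)) := Real.sq_sqrt (by positivity)
  have hmδ : #U * δ ≤ 1 := by
    refine abs_le_of_sq_le_sq' ?_ zero_le_one |>.2
    rw [mul_pow, hδ2, one_pow, mul_div_assoc', div_le_one (by positivity)]
    calc _ = (#U : ℝ) ^ 3 * a := by ring
      _ ≤ _ := hT
  have hδ1 : δ ≤ 1 / 2 := by nlinarith
  have henv : ∀ δ', 0 ≤ δ' → δ' < 1 → ∀ i, ∑ v, 𝔼 b : Fin T × K → Bool,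
      envDensity δ' i b * runRegret (P v) (q v) (bitLoss U b) T i ≤ R := by
    intro δ' h0 h1 i
    rw [← expect_sum_comm]
    calc _ ≤ 𝔼 b : Fin T × K → Bool, envDensity δ' i b * R := by
          refine expect_le_expect fun b _ => ?_
          rw [← mul_sum]
          exact mul_le_mul_of_nonneg_left
            ((sum_runRegret_le_regret hiso hq0 F f σ _ T i).trans (hb₀ b))
            (envDensity_nonneg h0 h1 i b)
      _ = R := by rw [← expect_mul, expect_envDensity, one_mul]
  have hB0 : ∀ v, 0 ≤ offRate (P v) (q v) U T := fun v => offRate_nonneg _ (hq0 v) (hq1 v) U T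
  obtain ⟨i₀, hi₀⟩ : U.Nonempty := card_pos.1 (by omega)
  have hB : ∑ v, offRate (P v) (q v) U T ≤ 2 * R := by
    have h := henv 0 le_rfl zero_lt_one i₀
    have h' : ∑ v, 1 / 2 * offRate (P v) (q v) U T ≤ R := by
      refine (sum_le_sum fun v _ => ?_).trans h
      have := le_expect_runRegret_zero (T := T) (hloc v) (q v) hi₀
      simp only [envRate_zero] at this
      refine this.trans_eq (expect_congr rfl fun b _ => ?_)
      simp [envDensity, tilt]
    rw [← mul_sum] at h'
    linarith
  have hR0 : 0 ≤ R := by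
    have := sum_nonneg fun v (_ : v ∈ univ) => hB0 v
    linarith
  refine regret_bound_arith hm ha0 hQ hTpos hδ0 hδ2 hmδ hB hR0 ?_
  have hmR : ∑ v, ∑ i ∈ U, 𝔼 b : Fin T × K → Bool,
      envDensity δ i b * runRegret (P v) (q v) (bitLoss U b) T i ≤ #U * R := by
    rw [sum_comm, ← nsmul_eq_mul]
    exact sum_le_card_nsmul _ _ _ fun i _ => henv δ hδ0 (by linarith) i
  refine le_trans ?_ ((sum_le_sum fun v _ => le_sum_expect_runRegret (hloc v) (hq0 v) (hq1 v) T hU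
    hδ0 hδ1).trans hmR)
  rw [← mul_sum]
  refine mul_le_mul_of_nonneg_left ?_ (by linarith)
  -- Replacing the inner `q v` by Q/a makes the bound linear in `q v` and `offRate`, so that it can
  -- be summed over agents; for `q v = 0` the left side is nonpositive and the right side zero.
  have hpt : ∀ v, T * (q v * (7 / 8 * #U - 1 - 8 * δ ^ 2 * (2 * (Q / a * T))) -
      8 * δ ^ 2 * #U * (Q / a) * offRate (P v) (q v) U T) ≤
      q v * T * (7 / 8 * #U - 1 - 8 * δ ^ 2 * (2 * (q v * T) + #U * offRate (P v) (q v) U T)) := by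
    intro v
    rcases hq v with h | h
    · have : 0 ≤ 8 * δ ^ 2 * #U * (Q / a) * offRate (P v) (q v) U T :=
        mul_nonneg (by positivity) (hB0 v)
      rw [h] at this ⊢
      nlinarith
    · have hqv := h.symm
      rw [hqv]
      apply le_of_eq
      ring
  refine le_trans (le_of_eq ?_) (sum_le_sum fun v _ => hpt v)
  rw [← mul_sum, sum_sub_distrib, ← sum_mul, hqsum, ← mul_sum]

end CoopBandit

end

theorem theorem3 :
    ∃ c C : ℝ, 0 < c ∧ 0 < C ∧
      ∀ (A K : Type*) [Fintype A] [DecidableEq A] [Fintype K] [Nontrivial K]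
        (N : SimpleGraph A) (n : ℕ) (F : SimpleGraph K) (f : ℕ) (Q : ℝ) (T : ℕ),
        (N = ⊤ ∨ N = ⊥ ∨ F = ⊤ ∨ F = ⊥) →
        0 < Q → Q ≤ ((CoopBandit.power N n).indepNum : ℝ) →
        C * ((CoopBandit.power N n).indepNum : ℝ) *
            ((CoopBandit.power F f).indepNum : ℝ) ^ 3 ≤ Q * T →
        ((c * √(Q * ((CoopBandit.strongProd (CoopBandit.power N n)
            (CoopBandit.power F f)).indepNum : ℝ) * T) : ℝ) : EReal) ≤
          CoopBandit.minimaxRegret N n F f Q T := by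
  -- With X = δQT, the regret is at least X/16 and the square root is at most √128 X ≤ 16X, whence
  -- 1/256. Since #U ≤ 2α(F^f), C = 1 already gives #U³a ≤ 8QT.
  refine ⟨1 / 256, 1, by norm_num, one_pos, ?_⟩
  intro A K _ _ _ _ N n F f Q T hNF hQ hQa hT
  classical
  rcases isEmpty_or_nonempty A with hA | hA
  · obtain ⟨S, hS⟩ := (CoopBandit.power N n).exists_isNIndepSet_indepNum
    rw [← hS.card_eq, Finset.eq_empty_of_isEmpty S] at hQa
    simp at hQa
    linarith
  obtain ⟨S, hS⟩ := (CoopBandit.power N n).exists_isNIndepSet_indepNum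
  obtain ⟨U, hU2, hUa, hUb, hU⟩ := CoopBandit.exists_hard_actions F f
  set a : ℝ := ((CoopBandit.power N n).indepNum : ℝ) with ha
  have ha1 : 1 ≤ a := by
    rw [ha]
    exact_mod_cast CoopBandit.indepNum_pos (CoopBandit.power N n)
  have ha0 : 0 < a := by linarith
  set q : A → ℝ := fun v => if v ∈ S then Q / a else 0 with hqdef
  have hSpos : ∀ v, 0 < q v → v ∈ S := by
    intro v hv
    by_contra h
    simp [hqdef, h] at hv
  have hiso : ∀ u v, 0 < q u → 0 < q v → N.edist u v ≤ n → u = v := by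
    intro u v hu hv huv
    by_contra hne
    exact hS.isIndepSet (by simpa using hSpos u hu) (by simpa using hSpos v hv) hne ⟨hne, huv⟩
  have hq : ∀ v, q v = 0 ∨ q v = Q / a := by
    intro v
    by_cases h : v ∈ S <;> simp [hqdef, h]
  have hqsum : ∑ v, q v = Q := by
    simp only [hqdef, Finset.sum_ite_mem, Finset.univ_inter, Finset.sum_const, hS.card_eq,
      nsmul_eq_mul, ← ha]
    field_simp
  have hact : CoopBandit.IsActivation Q q := by
    refine ⟨fun v => ?_, hqsum⟩
    rcases hq v with h | h <;> rw [h]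
    · simp
    · exact ⟨by positivity, (div_le_one ha0).2 hQa⟩
  have hb : (Finset.card U : ℝ) ≤ 2 * ((CoopBandit.power F f).indepNum : ℝ) := by exact_mod_cast hUb
  have hU3 : (Finset.card U : ℝ) ^ 3 * a ≤ 128 * (Q * T) := by
    have h8 := pow_le_pow_left₀ (Nat.cast_nonneg _) hb 3
    have := mul_le_mul_of_nonneg_right h8 ha0.le
    have hQT : 0 ≤ Q * T := by positivity
    nlinarith
  refine le_iInf fun σ => ?_
  obtain ⟨ℓ, hℓ, hreg⟩ := CoopBandit.exists_losses_le_regret (n := n) hiso ha1 hQ hQa hq hqsum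
    F f σ hU2 hU hU3
  refine le_iSup_of_le ⟨q, hact⟩ (le_iSup_of_le ⟨ℓ, hℓ⟩ ?_)
  refine EReal.coe_le_coe_iff.2 ?_
  refine le_trans ?_ (le_of_le_of_eq hreg (by congr))
  have hm : (2 : ℝ) ≤ Finset.card U := by exact_mod_cast hU2
  have hQT : 0 < Q * T := by
    have : 0 < (Finset.card U : ℝ) ^ 3 * a := by positivity
    linarith
  have hprod : ((CoopBandit.strongProd (CoopBandit.power N n)
      (CoopBandit.power F f)).indepNum : ℝ) ≤ a * Finset.card U := by
    have := (CoopBandit.indepNum_strongProd_power_le N n F f hNF).trans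
      (Nat.mul_le_mul_left _ hUa)
    rw [ha]
    exact_mod_cast this
  set X := √(Finset.card U * a / (128 * (Q * T))) * (Q * T) with hX
  have hX0 : 0 ≤ X := by positivity
  have hX2 : X ^ 2 = Finset.card U * a * (Q * T) / 128 := by
    rw [hX, mul_pow, Real.sq_sqrt (by positivity)]
    field_simp
  have hsq : √(Q * ((CoopBandit.strongProd (CoopBandit.power N n)
      (CoopBandit.power F f)).indepNum : ℝ) * T) ≤ 16 * X := by
    rw [Real.sqrt_le_left (by positivity), mul_pow, hX2]
    have := mul_le_mul_of_nonneg_left hprod hQT.le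
    have h0 : 0 ≤ Finset.card U * a * (Q * T) := by positivity
    linarith
  linarith
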